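/- Let $q(w,x,y,z) = R(w), S_1(w,x), S_2(x,y), S_3(y,z), T(z)$. For a database $D$ over the domain $[n]$ (that is, $R,T\subseteq[n]$ and $S_1,S_2,S_3\subseteq[n]^2$) let $q(D)$ be the set of all $(w,x,y,z)\in[n]^4$ with $w\in R$, $(w,x)\in S_1$, $(x,y)\in S_2$, $(y,z)\in S_3$, $z\in T$. Let $\mathcal I_n$ be the family of databases over $[n]$ in which $S_1,S_2,S_3$ are matchings (each value of $[n]$ occurs exactly once in each column) and $|R|=|T|=\lfloor\sqrt n\rfloor$. A one-round algorithm with $p$ workers works as follows. Each of the five relations is stored on its own input server; every input server sends to every worker a bit string that depends only on its relation and on random bits, which are independent of the input and visible to all servers; every worker then outputs a set of tuples that depends only on the messages it received and on the random bits. Computational power is unlimited. The algorithm is an $\mathrm{MPC}(\varepsilon)$ algorithm with constant $c$ on $\mathcal I_n$ if, on every $D\in\mathcal I_n$ and for all random bits, every worker receives at most $c\,N/p^{1-\varepsilon}$ bits, where $N=n\log_2 n$. The algorithm *produces a witness* on $D$ if some worker outputs at least one tuple and all tuples output by that worker belong to $q(D)$. It *solves Join-Witness* on $\mathcal I_n$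 with failure probability at most $\eta$ if, for every $D\in\mathcal I_n$ with $q(D)\neq\emptyset$, it produces a witness on $D$ with probability at least $1-\eta$. **Proposition.** There is a constant $K\in\mathbb N$ such that for all $0\le\varepsilon<1/2$ and $c>0$ the following hold. 1. There is a constant $C=C(\varepsilon,c)$ such that for all $p\ge 1$ and $n\ge p^K$ and every (randomized) one-round $\mathrm{MPC}(\varepsilon)$ algorithm with constant $c$ on $\mathcal I_n$ with $p$ workers: (a) if $D$ is drawn uniformly at random from $\mathcal I_n$, the algorithm produces a witness on $D$ with probability at most $C\,p^{-(1-2\varepsilon)}$; and (b) there is a database $D\in\mathcal I_n$ with $q(D)\ne\emptyset$ on which the algorithm produces a witness with probability at most $C\,p^{-(1-2\varepsilon)}$ over its random bits. 2. For every $\eta<1$ there is $p_0$ such that for all $p\ge p_0$ and $n\ge p^K$ no one-round $\mathrm{MPC}(\varepsilon)$ algorithm with constant $c$ on $\mathcal I_n$ with $p$ workers solves Join-Witness for $q$ on $\mathcal I_n$ with failure probability at most $\eta$. -/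

import Mathlib

open MeasureTheory

namespace JoinWitness

/-- A database instance over the domain `[n]` (encoded as `Fin n`) for the vocabulary of the query
`q(w,x,y,z) = R(w), S₁(w,x), S₂(x,y), S₃(y,z), T(z)`. -/
@[ext] structure Database (n : ℕ) where
  R : Finset (Fin n)
  S₁ : Finset (Fin n × Fin n)
  S₂ : Finset (Fin n × Fin n)
  S₃ : Finset (Fin n × Fin n)
  T : Finset (Fin n)

instance (n : ℕ) : Finite (Database n) :=
  Finite.of_injective (fun D : Database n => (D.R, D.S₁, D.S₂, D.S₃, D.T)) (by
    intro D E h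
    simp only [Prod.mk.injEq] at h
    exact Database.ext h.1 h.2.1 h.2.2.1 h.2.2.2.1 h.2.2.2.2)

noncomputable instance (n : ℕ) : Fintype (Database n) := Fintype.ofFinite _

/-- Candidate answers `(w, x, y, z)`. -/
abbrev Answer (n : ℕ) : Type := Fin n × Fin n × Fin n × Fin n

/-- The relation defined by the query `q` on the database `D`. -/
def Database.answers {n : ℕ} (D : Database n) : Set (Answer n) :=
  {t | t.1 ∈ D.R ∧ (t.1, t.2.1) ∈ D.S₁ ∧ (t.2.1, t.2.2.1) ∈ D.S₂ ∧
    (t.2.2.1, t.2.2.2) ∈ D.S₃ ∧ t.2.2.2 ∈ D.T}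

/-- A two-dimensional matching on `[n]`: every value occurs exactly once in each column. -/
def IsMatching {n : ℕ} (S : Finset (Fin n × Fin n)) : Prop :=
  (∀ a, ∃! b, (a, b) ∈ S) ∧ (∀ b, ∃! a, (a, b) ∈ S)

open scoped Classical in
/-- The input family: `S₁, S₂, S₃` are matchings, and `R, T` are subsets of `[n]` of
size `⌊√n⌋`. -/
noncomputable def inputs (n : ℕ) : Finset (Database n) :=
  Finset.univ.filter fun D =>
    D.R.card = Nat.sqrt n ∧ IsMatching D.S₁ ∧ IsMatching D.S₂ ∧ IsMatching D.S₃ ∧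
      D.T.card = Nat.sqrt n

/-- The five messages (bit strings) that a worker receives, one from each input server. -/
structure Received where
  fromR : List Bool
  fromS₁ : List Bool
  fromS₂ : List Bool
  fromS₃ : List Bool
  fromT : List Bool

/-- Total number of bits received. -/
def Received.bits (m : Received) : ℕ :=
  m.fromR.length + m.fromS₁.length + m.fromS₂.length + m.fromS₃.length + m.fromT.length

/-- A deterministic one-round algorithm with `p` workers for databases over `[n]`. Each relation
is held by its own input server, which sends to every worker a bit string that depends on that
relation only; every worker then outputs a set of tuples that depends only on what it received.
Computational power is unlimited. -/
structure OneRoundAlgorithm (n p : ℕ) where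
  msgR : Finset (Fin n) → Fin p → List Bool
  msgS₁ : Finset (Fin n × Fin n) → Fin p → List Bool
  msgS₂ : Finset (Fin n × Fin n) → Fin p → List Bool
  msgS₃ : Finset (Fin n × Fin n) → Fin p → List Bool
  msgT : Finset (Fin n) → Fin p → List Bool
  output : Fin p → Received → Set (Answer n)

namespace OneRoundAlgorithm

variable {n p : ℕ}

/-- What worker `u` receives on input `D`. -/
def received (A : OneRoundAlgorithm n p) (D : Database n) (u : Fin p) : Received where
  fromR := A.msgR D.R u
  fromS₁ := A.msgS₁ D.S₁ u
  fromS₂ := A.msgS₂ D.S₂ u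
  fromS₃ := A.msgS₃ D.S₃ u
  fromT := A.msgT D.T u

/-- The set of tuples that worker `u` outputs on input `D`. -/
def outputOn (A : OneRoundAlgorithm n p) (D : Database n) (u : Fin p) : Set (Answer n) :=
  A.output u (A.received D u)

/-- Some worker outputs at least one tuple, and all tuples that it outputs are answers.
(Without the second requirement a worker could list all of `[n]⁴`. An incorrect output of another
worker is not held against the algorithm.) -/
def ProducesWitness (A : OneRoundAlgorithm n p) (D : Database n) : Prop :=
  ∃ u : Fin p, (A.outputOn D u).Nonempty ∧ A.outputOn D u ⊆ D.answers

end OneRoundAlgorithm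

/-- A randomized one-round algorithm: the random bits `ω`, chosen independently of the input, are
visible to all input servers and workers. -/
structure RandomizedAlgorithm (n p : ℕ) where
  Ω : Type*
  mΩ : MeasurableSpace Ω
  μ : Measure Ω
  prob : IsProbabilityMeasure μ
  run : Ω → OneRoundAlgorithm n p
  measurable_output : ∀ (D : Database n) (u : Fin p) (O : Set (Answer n)),
    MeasurableSet {ω | (run ω).outputOn D u = O}

/-- The number of bits of an input over `[n]`, up to a constant factor: `n log₂ n`. -/
noncomputable def inputBits (n : ℕ) : ℝ := n * Real.logb 2 n

namespace RandomizedAlgorithm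

variable {n p : ℕ}

/-- The communication bound of the `MPC(ε)` model, with constant `c`: every worker receives at
most `c · N / p^(1-ε)` bits. It is required on the input family only. -/
def IsMPC (A : RandomizedAlgorithm n p) (ε c : ℝ) : Prop :=
  ∀ ω : A.Ω, ∀ D ∈ inputs n, ∀ u : Fin p,
    ((((A.run ω).received D u).bits : ℕ) : ℝ) ≤ c * inputBits n / (p : ℝ) ^ (1 - ε)

/-- The probability, over the random bits, that `A` produces a witness on the input `D`. -/
noncomputable def witnessProb (A : RandomizedAlgorithm n p) (D : Database n) : ℝ :=
  letI := A.mΩ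
  A.μ.real {ω | (A.run ω).ProducesWitness D}

/-- The probability that `A` produces a witness when the input is, moreover, drawn uniformly at
random from the input family. -/
noncomputable def avgWitnessProb (A : RandomizedAlgorithm n p) : ℝ :=
  (∑ D ∈ inputs n, A.witnessProb D) / (inputs n).card

/-- `A` solves Join-Witness with failure probability at most `η` on the input family: whenever
the query has an answer, `A` produces one with probability at least `1 - η`. -/
def SolvesJoinWitness (A : RandomizedAlgorithm n p) (η : ℝ) : Prop :=
  ∀ D ∈ inputs n, D.answers.Nonempty → 1 - η ≤ A.witnessProb D

end RandomizedAlgorithm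

end JoinWitness

/-! Give every worker `R`, `T` and `S₂` for free. Its answer is then a guess computed from its
messages about `S₁` and `S₃`. Call a pair heavy if its conditional probability, given the message
about its matching, is at least `1 / d`. A guess using a light pair of `S₁` or `S₃` is right with
probability at most `2 / d` (`card_light_guess_le`).

Otherwise the guess uses a heavy pair on both sides. Each row has at most `d` heavy entries, so a
union bound over the short messages shows that a random matching contains about `k` heavy pairs at
most, where `k / n` is of the order of the fraction `f = p^(-(1-ε))` of the input that a worker
receives (`sum_card_heavy_le`). Heaviness is independent of `R`, `T` and `S₂`, so two heavy pairs
form an answer with probability `(s/n)² · (1/n) ≤ 1/n²`, where `s = ⌊√n⌋`; the expected number of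
such answers is `O(f²)` (`sum_heavy_answers_le`). With `d = p²`, summing over the workers gives `O(p
f²) = O(p^(-(1-2ε)))`.

A constant fraction of the inputs has answers, so some input with an answer is as bad as the
average, up to a factor of 5. -/

namespace JoinWitness

/-! ### Counting permutations and subsets -/

section Permutations

variable {n : ℕ}

open scoped Classical in
/-- At most `(n - k)!` permutations extend a given partial map on `k` points. -/
lemma card_perm_eqOn_le (A : Finset (Fin n)) (f : ∀ a ∈ A, Fin n) :
    (Finset.univ.filter fun σ : Equiv.Perm (Fin n) => ∀ a (h : a ∈ A), σ a = f a h).card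
      ≤ (n - A.card).factorial := by
  rcases Finset.eq_empty_or_nonempty
    (Finset.univ.filter fun σ : Equiv.Perm (Fin n) => ∀ a (h : a ∈ A), σ a = f a h) with h0 | ⟨τ, hτ⟩
  · simp [h0]
  simp only [Finset.mem_filter, Finset.mem_univ, true_and] at hτ
  have hcard : Fintype.card {a : Fin n // a ∉ A} = n - A.card := by
    rw [Fintype.card_subtype_compl]
    simp
  -- Dividing by one extension `τ` leaves permutations that fix `A` pointwise, that is, permutations
  -- of the complement.
  rw [← hcard, ← Fintype.card_perm,
    Fintype.card_congr (Equiv.Perm.subtypeEquivSubtypePerm fun a : Fin n => a ∉ A),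
    Fintype.card_subtype]
  refine Finset.card_le_card_of_injOn (fun σ => τ⁻¹ * σ) ?_ ?_
  · intro σ hσ
    simp only [Finset.coe_filter, Finset.mem_univ, true_and, Set.mem_ofPred_eq, not_not] at hσ ⊢
    intro a ha
    rw [Equiv.Perm.mul_apply, hσ a ha, ← hτ a ha]
    simp
  · intro σ _ σ' _ h
    exact mul_left_cancel h

open scoped Classical in
/-- If every row of `G` has at most `d` entries, few permutations meet `G` in `k` places. -/
lemma card_perm_inter_ge_le (G : Fin n → Fin n → Prop) (d k : ℕ)
    (hG : ∀ a, (Finset.univ.filter fun b => G a b).card ≤ d) :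
    (Finset.univ.filter fun σ : Equiv.Perm (Fin n) =>
      k ≤ (Finset.univ.filter fun a => G a (σ a)).card).card * k.factorial
      ≤ d ^ k * n.factorial := by
  -- Union bound over the `k` places and over the at most `d ^ k` choices of values there.
  have hsub : (Finset.univ.filter fun σ : Equiv.Perm (Fin n) =>
      k ≤ (Finset.univ.filter fun a => G a (σ a)).card) ⊆
      (Finset.univ.powersetCard k).biUnion fun A : Finset (Fin n) =>
        (A.pi fun a => Finset.univ.filter fun b => G a b).biUnion fun f =>
          Finset.univ.filter fun σ : Equiv.Perm (Fin n) => ∀ a (h : a ∈ A), σ a = f a h := by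
    intro σ hσ
    simp only [Finset.mem_filter, Finset.mem_univ, true_and] at hσ
    obtain ⟨A, hA, hAk⟩ := Finset.exists_subset_card_eq hσ
    simp only [Finset.mem_biUnion]
    refine ⟨A, by simp [Finset.mem_powersetCard, hAk], fun a _ => σ a, ?_, by simp⟩
    rw [Finset.mem_pi]
    intro a ha
    simpa using hA ha
  have hle : (Finset.univ.filter fun σ : Equiv.Perm (Fin n) =>
      k ≤ (Finset.univ.filter fun a => G a (σ a)).card).card
        ≤ n.choose k * (d ^ k * (n - k).factorial) := by
    refine (Finset.card_le_card hsub).trans ?_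
    have : n.choose k = (Finset.univ.powersetCard k : Finset (Finset (Fin n))).card := by simp
    rw [this]
    refine Finset.card_biUnion_le_card_mul _ _ _ fun A hA => ?_
    obtain ⟨-, rfl⟩ := Finset.mem_powersetCard.1 hA
    refine (Finset.card_biUnion_le_card_mul _ _ _ fun f _ => card_perm_eqOn_le A f).trans ?_
    gcongr
    rw [Finset.card_pi]
    exact Finset.prod_le_pow_card _ _ _ fun a _ => hG a
  calc _ ≤ n.choose k * (d ^ k * (n - k).factorial) * k.factorial := by gcongr
    _ = d ^ k * (n.choose k * k.factorial * (n - k).factorial) := by ring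
    _ ≤ d ^ k * n.factorial := by
      gcongr
      rcases le_or_gt k n with h | h
      · exact (Nat.choose_mul_factorial_mul_factorial h).le
      · simp [Nat.choose_eq_zero_of_lt h]

/-- A given value is taken at a given point by a fraction `1 / n` of the permutations. -/
lemma card_perm_apply_eq (a b : Fin n) :
    n * (Finset.univ.filter fun σ : Equiv.Perm (Fin n) => σ a = b).card = n.factorial := by
  have hconst : ∀ b', (Finset.univ.filter fun σ : Equiv.Perm (Fin n) => σ a = b').card
      = (Finset.univ.filter fun σ : Equiv.Perm (Fin n) => σ a = b).card := by
    intro b'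
    refine Finset.card_bij (fun σ _ => Equiv.swap b' b * σ) ?_ ?_ ?_
    · intro σ hσ
      simp only [Finset.mem_filter, Finset.mem_univ, true_and] at hσ ⊢
      simp [hσ]
    · intro σ _ σ' _ h
      exact mul_left_cancel h
    · intro σ hσ
      simp only [Finset.mem_filter, Finset.mem_univ, true_and] at hσ
      exact ⟨Equiv.swap b' b * σ, by simp [hσ], by simp [← mul_assoc]⟩
  have hsum := Finset.card_eq_sum_card_fiberwise (s := (Finset.univ : Finset (Equiv.Perm (Fin n))))
    (t := Finset.univ) (f := fun σ => σ a) (by simp [Set.MapsTo])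
  simp only [hconst, Finset.sum_const, Finset.card_univ, Fintype.card_perm, Fintype.card_fin,
    smul_eq_mul] at hsum
  exact hsum.symm

/-- A given point lies in a fraction `s / n` of the sets of size `s`. -/
lemma card_powersetCard_mem (s : ℕ) (a : Fin n) :
    n * ((Finset.univ.powersetCard s).filter fun R : Finset (Fin n) => a ∈ R).card
      = s * n.choose s := by
  have hconst : ∀ a', ((Finset.univ.powersetCard s).filter fun R : Finset (Fin n) => a' ∈ R).card
      = ((Finset.univ.powersetCard s).filter fun R : Finset (Fin n) => a ∈ R).card := by
    intro a'
    refine Finset.card_bij (fun R _ => R.map (Equiv.swap a' a).toEmbedding) ?_ ?_ ?_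
    · intro R hR
      simp only [Finset.mem_filter, Finset.mem_powersetCard, Finset.subset_univ, true_and] at hR ⊢
      refine ⟨by simpa using hR.1, ?_⟩
      rw [Finset.mem_map_equiv]
      simpa using hR.2
    · intro R _ R' _ h
      exact Finset.map_injective _ h
    · intro R hR
      simp only [Finset.mem_filter, Finset.mem_powersetCard, Finset.subset_univ, true_and] at hR
      refine ⟨R.map (Equiv.swap a' a).toEmbedding, ?_, ?_⟩
      · simp only [Finset.mem_filter, Finset.mem_powersetCard, Finset.subset_univ, true_and,
          Finset.card_map]
        refine ⟨hR.1, ?_⟩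
        rw [Finset.mem_map_equiv]
        simpa using hR.2
      · ext x
        simp [Finset.mem_map_equiv]
  -- Double counting of the incidences `a ∈ R`.
  have h2 := Finset.sum_card_bipartiteAbove_eq_sum_card_bipartiteBelow
    (s := (Finset.univ : Finset (Fin n))) (t := Finset.univ.powersetCard s)
    (fun a R => a ∈ R)
  simp only [Finset.bipartiteAbove, Finset.bipartiteBelow] at h2
  rw [Finset.sum_congr rfl fun a' _ => hconst a'] at h2
  simp only [Finset.sum_const, Finset.card_univ, Fintype.card_fin, smul_eq_mul] at h2
  rw [h2, Finset.sum_congr rfl (g := fun _ => s)]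
  · simp [mul_comm]
  · intro R hR
    simpa using (Finset.mem_powersetCard.1 hR).2

end Permutations

/-! ### What a short message reveals about a random matching -/

section Messages

variable {n : ℕ} {β : Type*}

open scoped Classical in
/-- Given the message `m`, the pair `(a, b)` is in the matching with probability at least `1 / d`. -/
def Heavy (d : ℕ) (g : Equiv.Perm (Fin n) → β) (m : β) (a b : Fin n) : Prop :=
  (Finset.univ.filter fun σ => g σ = m).card
    ≤ d * (Finset.univ.filter fun σ => g σ = m ∧ σ a = b).card

open scoped Classical in
/-- Guessing a pair that is not heavy is correct with probability at most `1 / d`. -/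
lemma card_light_guess_le (d : ℕ) (g : Equiv.Perm (Fin n) → β) (a b : β → Fin n) :
    d * (Finset.univ.filter fun σ : Equiv.Perm (Fin n) =>
      σ (a (g σ)) = b (g σ) ∧ ¬ Heavy d g (g σ) (a (g σ)) (b (g σ))).card ≤ n.factorial := by
  have h1 := Finset.card_eq_sum_card_image g (Finset.univ : Finset (Equiv.Perm (Fin n)))
  have h2 := Finset.card_eq_sum_card_fiberwise
    (s := Finset.univ.filter fun σ : Equiv.Perm (Fin n) =>
      σ (a (g σ)) = b (g σ) ∧ ¬ Heavy d g (g σ) (a (g σ)) (b (g σ)))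
    (t := Finset.univ.image g) (f := g) (by intro σ _; simp)
  rw [h2, Finset.mul_sum]
  simp only [Finset.card_univ, Fintype.card_perm, Fintype.card_fin] at h1
  rw [h1]
  refine Finset.sum_le_sum fun m _ => ?_
  -- For a fixed message the guess is fixed: a heavy guess contributes nothing, and for a light one
  -- the bound is the negation of `Heavy`.
  by_cases hm : Heavy d g m (a m) (b m)
  · rw [Finset.filter_filter, Finset.filter_false_of_mem]
    · simp
    · rintro σ - ⟨⟨-, h⟩, rfl⟩
      exact h hm
  · refine le_trans ?_ (not_le.1 hm).le
    gcongr
    intro σ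
    simp only [Finset.mem_filter, Finset.mem_univ, true_and]
    rintro ⟨⟨h, -⟩, rfl⟩
    exact ⟨rfl, h⟩

-- The conditional probabilities in a row sum to one and each heavy entry takes at least `1 / d`.
-- Taking the message of some `τ` matters: for a message that never occurs, every pair is heavy.
open scoped Classical in
lemma card_heavy_row_le (d : ℕ) (g : Equiv.Perm (Fin n) → β) (τ : Equiv.Perm (Fin n))
    (a : Fin n) : (Finset.univ.filter fun b => Heavy d g (g τ) a b).card ≤ d := by
  set F := Finset.univ.filter fun σ => g σ = g τ with hF
  have hpos : 0 < F.card := Finset.card_pos.2 ⟨τ, by simp [hF]⟩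
  have hsum := Finset.card_eq_sum_card_fiberwise (s := F)
    (t := Finset.univ) (f := fun σ => σ a) (by simp [Set.MapsTo])
  refine Nat.le_of_mul_le_mul_right ?_ hpos
  calc (Finset.univ.filter fun b => Heavy d g (g τ) a b).card * F.card
      = ∑ b ∈ Finset.univ.filter fun b => Heavy d g (g τ) a b, F.card := by simp
    _ ≤ ∑ b ∈ Finset.univ.filter fun b => Heavy d g (g τ) a b,
          d * (F.filter fun σ => σ a = b).card := by
        refine Finset.sum_le_sum fun b hb => ?_
        have := (Finset.mem_filter.1 hb).2
        rwa [Heavy, ← Finset.filter_filter] at this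
    _ ≤ ∑ b, d * (F.filter fun σ => σ a = b).card :=
        Finset.sum_le_sum_of_subset (Finset.filter_subset _ _)
    _ = d * F.card := by rw [← Finset.mul_sum, ← hsum]

open scoped Classical in
/-- On average, at most `k + 1` of the pairs of a random matching are heavy. -/
lemma sum_card_heavy_le (d k B : ℕ) (g : Equiv.Perm (Fin n) → β)
    (hB : (Finset.univ.image g).card ≤ B) (hk : n * B * d ^ k ≤ k.factorial) :
    ∑ σ : Equiv.Perm (Fin n), (Finset.univ.filter fun a => Heavy d g (g σ) a (σ a)).card
      ≤ (k + 1) * n.factorial := by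
  set W := Finset.univ.filter fun σ : Equiv.Perm (Fin n) =>
    k ≤ (Finset.univ.filter fun a => Heavy d g (g σ) a (σ a)).card with hW
  have hWcard : W.card * k.factorial ≤ B * (d ^ k * n.factorial) := by
    -- Once the message is fixed, the heavy pairs form a fixed relation, to which
    -- `card_perm_inter_ge_le` applies.
    have hsub : W ⊆ (Finset.univ.image g).biUnion fun m => Finset.univ.filter fun σ =>
        g σ = m ∧ k ≤ (Finset.univ.filter fun a => Heavy d g m a (σ a)).card := by
      intro σ hσ
      simp only [hW, Finset.mem_filter, Finset.mem_univ, true_and] at hσ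
      simpa using ⟨σ, rfl, hσ⟩
    calc W.card * k.factorial
        ≤ (∑ m ∈ Finset.univ.image g, (Finset.univ.filter fun σ : Equiv.Perm (Fin n) =>
            g σ = m ∧ k ≤ (Finset.univ.filter fun a => Heavy d g m a (σ a)).card).card)
              * k.factorial := by
          gcongr
          exact (Finset.card_le_card hsub).trans Finset.card_biUnion_le
      _ ≤ ∑ m ∈ Finset.univ.image g, d ^ k * n.factorial := by
          rw [Finset.sum_mul]
          refine Finset.sum_le_sum fun m hm => ?_
          obtain ⟨τ, -, rfl⟩ := Finset.mem_image.1 hm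
          refine le_trans ?_ (card_perm_inter_ge_le (fun a b => Heavy d g (g τ) a b) d k
            (card_heavy_row_le d g τ))
          gcongr
          exact And.right
      _ ≤ B * (d ^ k * n.factorial) := by
          rw [Finset.sum_const, smul_eq_mul]
          gcongr
  -- Exceptional permutations have density at most `1 / n`, so the trivial bound `n` on them adds
  -- only 1 to the average.
  have hWn : n * W.card ≤ n.factorial := by
    refine Nat.le_of_mul_le_mul_right ?_ k.factorial_pos
    calc n * W.card * k.factorial = n * (W.card * k.factorial) := by ring
      _ ≤ n * (B * (d ^ k * n.factorial)) := by gcongr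
      _ = n * B * d ^ k * n.factorial := by ring
      _ ≤ k.factorial * n.factorial := by gcongr
      _ = n.factorial * k.factorial := mul_comm _ _
  calc ∑ σ : Equiv.Perm (Fin n), (Finset.univ.filter fun a => Heavy d g (g σ) a (σ a)).card
      ≤ ∑ σ : Equiv.Perm (Fin n), (k + if σ ∈ W then n else 0) := by
        refine Finset.sum_le_sum fun σ _ => ?_
        split_ifs with h
        · refine le_trans (Finset.card_le_univ _) ?_
          simp
        · simp only [hW, Finset.mem_filter, Finset.mem_univ, true_and, not_le] at h
          simpa using h.le
    _ = k * n.factorial + n * W.card := by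
        rw [Finset.sum_add_distrib, ← Finset.sum_filter]
        simp [Fintype.card_perm, mul_comm]
    _ ≤ (k + 1) * n.factorial := by
        rw [add_mul, one_mul]
        gcongr

/-- There are fewer than `2 ^ (ℓ + 1)` bit strings of length at most `ℓ`. -/
lemma card_bitstrings_le (ℓ : ℕ) (M : Finset (List Bool)) (hM : ∀ l ∈ M, l.length ≤ ℓ) :
    M.card ≤ 2 ^ (ℓ + 1) := by
  have hsub : M ⊆ (Finset.range (ℓ + 1)).biUnion fun i =>
      Finset.univ.image (List.ofFn : (Fin i → Bool) → List Bool) := by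
    intro l hl
    simp only [Finset.mem_biUnion, Finset.mem_range, Finset.mem_image, Finset.mem_univ, true_and]
    exact ⟨l.length, Nat.lt_succ_of_le (hM l hl), l.get, List.ofFn_get l⟩
  calc M.card ≤ ∑ i ∈ Finset.range (ℓ + 1), 2 ^ i := by
        refine (Finset.card_le_card hsub).trans (Finset.card_biUnion_le.trans ?_)
        refine Finset.sum_le_sum fun i _ => Finset.card_image_le.trans ?_
        simp
    _ ≤ 2 ^ (ℓ + 1) := (Nat.geomSum_lt le_rfl (by simp)).le

end Messages

/-! ### Inputs as two sets and three permutations -/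

section Inputs

variable {n : ℕ}

/-- The matching defined by a permutation. -/
def matchingOf (σ : Equiv.Perm (Fin n)) : Finset (Fin n × Fin n) :=
  Finset.univ.filter fun q => σ q.1 = q.2

@[simp] lemma mem_matchingOf (σ : Equiv.Perm (Fin n)) (a b : Fin n) :
    (a, b) ∈ matchingOf σ ↔ σ a = b := by
  simp [matchingOf]

lemma matchingOf_injective : Function.Injective (matchingOf (n := n)) := by
  intro σ τ h
  ext a
  have : (a, σ a) ∈ matchingOf τ := by rw [← h]; simp
  rw [(mem_matchingOf τ a (σ a)).1 this]

lemma isMatching_iff (S : Finset (Fin n × Fin n)) :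
    IsMatching S ↔ ∃ σ : Equiv.Perm (Fin n), matchingOf σ = S := by
  constructor
  · rintro ⟨h1, h2⟩
    choose f hf hf' using h1
    have hbij : Function.Bijective f := by
      constructor
      · intro a a' h
        exact (h2 (f a)).unique (hf a) (by rw [h]; exact hf a')
      · intro b
        obtain ⟨a, ha, -⟩ := h2 b
        exact ⟨a, (hf' a b ha).symm⟩
    refine ⟨Equiv.ofBijective f hbij, ?_⟩
    ext ⟨a, b⟩
    rw [mem_matchingOf, Equiv.ofBijective_apply]
    exact ⟨fun h => h ▸ hf a, fun h => (hf' a b h).symm⟩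
  · rintro ⟨σ, rfl⟩
    exact ⟨fun a => ⟨σ a, by simp, fun b hb => by simpa [eq_comm] using hb⟩,
      fun b => ⟨σ.symm b, by simp, fun a ha => by
        rw [Equiv.eq_symm_apply]; simpa using ha⟩⟩

/-- The database whose binary relations are the matchings of three permutations. -/
@[simps] def Database.ofPerms (R T : Finset (Fin n)) (σ₁ σ₂ σ₃ : Equiv.Perm (Fin n)) :
    Database n where
  R := R
  S₁ := matchingOf σ₁
  S₂ := matchingOf σ₂
  S₃ := matchingOf σ₃
  T := T

/-- The sets of size `⌊√n⌋`. -/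
abbrev unaryInputs (n : ℕ) : Finset (Finset (Fin n)) := Finset.univ.powersetCard (Nat.sqrt n)

lemma mem_inputs_iff (D : Database n) : D ∈ inputs n ↔
    ∃ R ∈ unaryInputs n, ∃ T ∈ unaryInputs n, ∃ σ₁ σ₂ σ₃, Database.ofPerms R T σ₁ σ₂ σ₃ = D := by
  simp only [inputs, Finset.mem_filter, Finset.mem_univ, true_and, isMatching_iff,
    Finset.mem_powersetCard, Finset.subset_univ]
  constructor
  · rintro ⟨hR, ⟨σ₁, h1⟩, ⟨σ₂, h2⟩, ⟨σ₃, h3⟩, hT⟩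
    exact ⟨D.R, hR, D.T, hT, σ₁, σ₂, σ₃, Database.ext rfl h1 h2 h3 rfl⟩
  · rintro ⟨R, hR, T, hT, σ₁, σ₂, σ₃, rfl⟩
    exact ⟨hR, ⟨σ₁, rfl⟩, ⟨σ₂, rfl⟩, ⟨σ₃, rfl⟩, hT⟩

/-- This is the independence of the five relations. `σ₂` precedes `σ₁` and `σ₃` because guesses are
analysed with `R`, `T`, `σ₂` fixed. -/
lemma sum_inputs {M : Type*} [AddCommMonoid M] (F : Database n → M) :
    ∑ D ∈ inputs n, F D = ∑ R ∈ unaryInputs n, ∑ T ∈ unaryInputs n,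
      ∑ σ₂ : Equiv.Perm (Fin n), ∑ σ₁ : Equiv.Perm (Fin n), ∑ σ₃ : Equiv.Perm (Fin n),
        F (.ofPerms R T σ₁ σ₂ σ₃) := by
  simp only [← Finset.sum_product']
  symm
  refine Finset.sum_bij (fun q _ => .ofPerms q.1 q.2.1 q.2.2.2.1 q.2.2.1 q.2.2.2.2) ?_ ?_ ?_ ?_
  · rintro ⟨R, T, σ₂, σ₁, σ₃⟩ h
    simp only [Finset.mem_product] at h
    exact (mem_inputs_iff _).2 ⟨R, h.1, T, h.2.1, σ₁, σ₂, σ₃, rfl⟩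
  · rintro ⟨R, T, σ₂, σ₁, σ₃⟩ _ ⟨R', T', σ₂', σ₁', σ₃'⟩ _ h
    have h1 := matchingOf_injective (congrArg Database.S₁ h)
    have h2 := matchingOf_injective (congrArg Database.S₂ h)
    have h3 := matchingOf_injective (congrArg Database.S₃ h)
    have h4 := congrArg Database.R h
    have h5 := congrArg Database.T h
    simp only [Database.ofPerms_R, Database.ofPerms_T] at h1 h2 h3 h4 h5
    rw [h1, h2, h3, h4, h5]
  · intro D hD
    obtain ⟨R, hR, T, hT, σ₁, σ₂, σ₃, rfl⟩ := (mem_inputs_iff D).1 hD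
    exact ⟨(R, T, σ₂, σ₁, σ₃), by simpa using ⟨by simpa using hR, by simpa using hT⟩, rfl⟩
  · intro _ _
    rfl

lemma card_inputs : (inputs n).card = n.choose (Nat.sqrt n) *
    (n.choose (Nat.sqrt n) * (n.factorial * (n.factorial * n.factorial))) := by
  rw [Finset.card_eq_sum_ones, sum_inputs]
  simp [Fintype.card_perm]

lemma mem_answers_ofPerms (R T : Finset (Fin n)) (σ₁ σ₂ σ₃ : Equiv.Perm (Fin n)) (t : Answer n) :
    t ∈ (Database.ofPerms R T σ₁ σ₂ σ₃).answers ↔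
      t.1 ∈ R ∧ σ₁ t.1 = t.2.1 ∧ σ₂ t.2.1 = t.2.2.1 ∧ σ₃ t.2.2.1 = t.2.2.2 ∧ t.2.2.2 ∈ T := by
  obtain ⟨w, x, y, z⟩ := t
  simp [Database.answers]

lemma sum_rotate {α β γ M : Type*} [AddCommMonoid M] (A : Finset α) (B : Finset β)
    (C : Finset γ) (F : α → β → γ → M) :
    ∑ a ∈ A, ∑ b ∈ B, ∑ c ∈ C, F a b c = ∑ b ∈ B, ∑ c ∈ C, ∑ a ∈ A, F a b c := by
  rw [Finset.sum_comm]
  exact Finset.sum_congr rfl fun _ _ => Finset.sum_comm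

end Inputs

/-! ### A constant fraction of the inputs has an answer -/

section Nonempty

variable {n : ℕ}

/-- Factor by factor, `(n - s - j) / (n - j) ≤ (n - s) / n`. -/
lemma descFactorial_mul_pow_le {s : ℕ} (hs : s ≤ n) (j : ℕ) :
    (n - s).descFactorial j * n ^ j ≤ (n - s) ^ j * n.descFactorial j := by
  induction j with
  | zero => simp
  | succ j ih =>
    have key : (n - s - j) * n ≤ (n - s) * (n - j) := by
      rcases le_or_gt (n - s) j with h | h
      · simp [Nat.sub_eq_zero_of_le h]
      · obtain ⟨i, hi⟩ := Nat.exists_eq_add_of_lt h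
        have h1 : n - s - j = i + 1 := by omega
        have h2 : n - j = s + (i + 1) := by omega
        have h3 : n = s + (j + i + 1) := by omega
        rw [h1, h2, hi]
        nlinarith [Nat.zero_le (j * s), Nat.zero_le (i * s)]
    rw [Nat.descFactorial_succ, Nat.descFactorial_succ, pow_succ, pow_succ]
    calc (n - s - j) * (n - s).descFactorial j * (n ^ j * n)
        = ((n - s - j) * n) * ((n - s).descFactorial j * n ^ j) := by ring
      _ ≤ ((n - s) * (n - j)) * ((n - s) ^ j * n.descFactorial j) := by gcongr
      _ = _ := by ring

/-- A random `s`-set avoids a given `s`-set with probability at most `(1 - s/n)^s ≤ exp(-s²/n) ≤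
exp(-1/4) ≤ 4/5`. -/
lemma choose_sub_sqrt_le (hn : 1 ≤ n) :
    ((n - Nat.sqrt n).choose (Nat.sqrt n) : ℝ) ≤ 4 / 5 * n.choose (Nat.sqrt n) := by
  set s := Nat.sqrt n with hs
  have hsn : s ≤ n := Nat.sqrt_le_self n
  have hs1 : 1 ≤ s := Nat.sqrt_pos.2 hn
  have hlt : n < (s + 1) * (s + 1) := Nat.lt_succ_sqrt n
  have hn0 : (0 : ℝ) < n := by exact_mod_cast hn
  have h1 : (n - s).choose s * n ^ s ≤ (n - s) ^ s * n.choose s := by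
    have := descFactorial_mul_pow_le hsn s
    rw [Nat.descFactorial_eq_factorial_mul_choose, Nat.descFactorial_eq_factorial_mul_choose] at this
    refine Nat.le_of_mul_le_mul_left ?_ s.factorial_pos
    linarith
  have h2 : ((n - s).choose s : ℝ) * n ^ s ≤ ((n : ℝ) - s) ^ s * n.choose s := by
    have : (((n - s).choose s * n ^ s : ℕ) : ℝ) ≤ (((n - s) ^ s * n.choose s : ℕ) : ℝ) := by
      exact_mod_cast h1
    push_cast [Nat.cast_sub hsn] at this
    exact this
  have h3 : ((n : ℝ) - s) ^ s ≤ 4 / 5 * n ^ s := by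
    have e1 : (n : ℝ) - s ≤ n * Real.exp (-(s / n)) := by
      have := Real.add_one_le_exp (-((s : ℝ) / n))
      calc (n : ℝ) - s = n * (-(s / n) + 1) := by field_simp; ring
        _ ≤ _ := by gcongr
    have e2 : Real.exp (-((s : ℝ) / n)) ^ s ≤ 4 / 5 := by
      rw [← Real.exp_nat_mul]
      have hq : (s : ℝ) * -(s / n) ≤ -(1 / 4) := by
        -- From `n < (s + 1)²` and `s ≥ 1`.
        have : (n : ℝ) ≤ 4 * (s * s) := by
          have : n ≤ 4 * (s * s) := by nlinarith
          exact_mod_cast this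
        have : (1 : ℝ) / 4 ≤ s * (s / n) := by
          rw [← mul_div_assoc, le_div_iff₀ hn0]
          linarith
        linarith
      calc Real.exp ((s : ℝ) * -(s / n)) ≤ Real.exp (-(1 / 4)) := Real.exp_le_exp.2 hq
        _ = (Real.exp (1 / 4))⁻¹ := Real.exp_neg _
        _ ≤ (5 / 4 : ℝ)⁻¹ := by
          gcongr
          have := Real.add_one_le_exp (1 / 4 : ℝ)
          linarith
        _ = 4 / 5 := by norm_num
    have hnn : (0 : ℝ) ≤ (n : ℝ) - s := by
      have : (s : ℝ) ≤ n := by exact_mod_cast hsn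
      linarith
    calc ((n : ℝ) - s) ^ s ≤ (n * Real.exp (-(s / n))) ^ s := by gcongr
      _ = Real.exp (-(s / n)) ^ s * n ^ s := by rw [mul_pow]; ring
      _ ≤ 4 / 5 * n ^ s := by gcongr
  have hpow : (0 : ℝ) < (n : ℝ) ^ s := by positivity
  refine le_of_mul_le_mul_right ?_ hpow
  calc ((n - s).choose s : ℝ) * n ^ s ≤ ((n : ℝ) - s) ^ s * n.choose s := h2
    _ ≤ 4 / 5 * n ^ s * n.choose s := by gcongr
    _ = _ := by ring

-- Following the three matchings maps `R` bijectively onto a set of the same size; there is no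
-- answer only if `T` avoids that set.
open scoped Classical in
lemma card_inputs_empty_le (hn : 1 ≤ n) :
    (((inputs n).filter fun D => ¬ D.answers.Nonempty).card : ℝ) ≤ 4 / 5 * (inputs n).card := by
  have hT : ∀ (R : Finset (Fin n)) (_ : R ∈ unaryInputs n) (σ₂ σ₁ σ₃ : Equiv.Perm (Fin n)),
      ∑ T ∈ unaryInputs n, (if ¬ (Database.ofPerms R T σ₁ σ₂ σ₃).answers.Nonempty then 1 else 0)
        ≤ (n - Nat.sqrt n).choose (Nat.sqrt n) := by
    intro R hR σ₂ σ₁ σ₃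
    obtain ⟨-, hR⟩ := Finset.mem_powersetCard.1 hR
    set R' := R.map ((σ₁.trans σ₂).trans σ₃).toEmbedding with hR'
    have hcard : R'ᶜ.card = n - Nat.sqrt n := by
      rw [Finset.card_compl, hR', Finset.card_map, hR, Fintype.card_fin]
    rw [← Finset.sum_filter, ← Finset.card_eq_sum_ones, ← hcard, ← Finset.card_powersetCard]
    refine Finset.card_le_card fun T hT => ?_
    obtain ⟨hT1, hT2⟩ := Finset.mem_filter.1 hT
    rw [Finset.mem_powersetCard] at hT1 ⊢
    refine ⟨fun z hz => ?_, hT1.2⟩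
    rw [Finset.mem_compl]
    intro hz'
    obtain ⟨w, hw, rfl⟩ := Finset.mem_map.1 hz'
    exact hT2 ⟨(w, σ₁ w, σ₂ (σ₁ w), σ₃ (σ₂ (σ₁ w))), by
      rw [mem_answers_ofPerms]; exact ⟨hw, rfl, rfl, rfl, hz⟩⟩
  have hcount : ((inputs n).filter fun D => ¬ D.answers.Nonempty).card ≤
      n.choose (Nat.sqrt n) * (n.factorial * (n.factorial * (n.factorial *
        (n - Nat.sqrt n).choose (Nat.sqrt n)))) := by
    rw [Finset.card_eq_sum_ones, Finset.sum_filter, sum_inputs]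
    calc _ ≤ ∑ R ∈ unaryInputs n, ∑ _σ₂ : Equiv.Perm (Fin n), ∑ _σ₁ : Equiv.Perm (Fin n),
            ∑ _σ₃ : Equiv.Perm (Fin n), (n - Nat.sqrt n).choose (Nat.sqrt n) := by
          refine Finset.sum_le_sum fun R hR => ?_
          rw [sum_rotate]
          refine Finset.sum_le_sum fun σ₂ _ => Finset.sum_le_sum fun σ₁ _ => ?_
          rw [Finset.sum_comm]
          exact Finset.sum_le_sum fun σ₃ _ => hT R hR σ₂ σ₁ σ₃
      _ = _ := by simp [Fintype.card_perm]
  have := choose_sub_sqrt_le hn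
  calc (((inputs n).filter fun D => ¬ D.answers.Nonempty).card : ℝ)
      ≤ n.choose (Nat.sqrt n) * (n.factorial * (n.factorial * (n.factorial *
        (n - Nat.sqrt n).choose (Nat.sqrt n)))) := by exact_mod_cast hcount
    _ ≤ n.choose (Nat.sqrt n) * (n.factorial * (n.factorial * (n.factorial *
        (4 / 5 * n.choose (Nat.sqrt n))))) := by gcongr
    _ = _ := by rw [card_inputs]; push_cast; ring

lemma inputs_nonempty (n : ℕ) : (inputs n).Nonempty := by
  rw [← Finset.card_pos, card_inputs]
  have := Nat.choose_pos (Nat.sqrt_le_self n)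
  have := n.factorial_pos
  positivity

open scoped Classical in
/-- At least a fifth of the inputs have an answer. -/
lemma card_inputs_le_nonempty (hn : 1 ≤ n) :
    ((inputs n).card : ℝ) ≤ 5 * ((inputs n).filter fun D => D.answers.Nonempty).card := by
  have h1 := card_inputs_empty_le hn
  have h2 : (((inputs n).filter fun D => D.answers.Nonempty).card : ℝ)
      + ((inputs n).filter fun D => ¬ D.answers.Nonempty).card = (inputs n).card := by
    exact_mod_cast Finset.card_filter_add_card_filter_not _
  linarith

end Nonempty

/-! ### Guesses of a worker and answers built from heavy pairs -/

section Worker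

variable {n p : ℕ}

/-- Worker `u` outputs at least one tuple, and only answers. -/
def OneRoundAlgorithm.Succeeds (A : OneRoundAlgorithm n p) (u : Fin p) (D : Database n) : Prop :=
  (A.outputOn D u).Nonempty ∧ A.outputOn D u ⊆ D.answers

/-- For fixed `R`, `T` and `S₂`, a successful worker determines an answer from its messages about
`S₁` and `S₃`. -/
lemma OneRoundAlgorithm.exists_guess (A : OneRoundAlgorithm n p) (u : Fin p) (x₀ : Fin n)
    (R T : Finset (Fin n)) (σ₂ : Equiv.Perm (Fin n)) :
    ∃ t : List Bool → List Bool → Answer n, ∀ σ₁ σ₃,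
      A.Succeeds u (.ofPerms R T σ₁ σ₂ σ₃) →
        t (A.msgS₁ (matchingOf σ₁) u) (A.msgS₃ (matchingOf σ₃) u) ∈
          (Database.ofPerms R T σ₁ σ₂ σ₃).answers := by
  classical
  let O : List Bool → List Bool → Set (Answer n) := fun m₁ m₃ =>
    A.output u ⟨A.msgR R u, m₁, A.msgS₂ (matchingOf σ₂) u, m₃, A.msgT T u⟩
  -- The default tuple is never used when the worker succeeds.
  refine ⟨fun m₁ m₃ => if h : (O m₁ m₃).Nonempty then h.some else (x₀, x₀, x₀, x₀), ?_⟩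
  rintro σ₁ σ₃ ⟨hne, hsub⟩
  have hne' : (O (A.msgS₁ (matchingOf σ₁) u) (A.msgS₃ (matchingOf σ₃) u)).Nonempty := hne
  beta_reduce
  rw [dif_pos hne']
  exact hsub hne'.some_mem

open scoped Classical in
/-- The expected number of answers that use heavy pairs of both `S₁` and `S₃`. -/
lemma sum_heavy_answers_le (h₁ h₃ : Equiv.Perm (Fin n) → Fin n → Prop) (H : ℕ)
    (hn : 1 ≤ n)
    (hh₁ : ∑ σ, (Finset.univ.filter fun a => h₁ σ a).card ≤ H * n.factorial)
    (hh₃ : ∑ σ, (Finset.univ.filter fun a => h₃ σ a).card ≤ H * n.factorial) :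
    n ^ 2 * (∑ R ∈ unaryInputs n, ∑ T ∈ unaryInputs n, ∑ σ₂ : Equiv.Perm (Fin n),
      ∑ σ₁ : Equiv.Perm (Fin n), ∑ σ₃ : Equiv.Perm (Fin n), ∑ w, ∑ y,
        (if h₁ σ₁ w then 1 else 0) * (if h₃ σ₃ y then 1 else 0) * (if w ∈ R then 1 else 0) *
          (if σ₃ y ∈ T then 1 else 0) * (if σ₂ (σ₁ w) = y then 1 else 0))
      ≤ H ^ 2 * (inputs n).card := by
  have hre : (∑ R ∈ unaryInputs n, ∑ T ∈ unaryInputs n, ∑ σ₂ : Equiv.Perm (Fin n),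
      ∑ σ₁ : Equiv.Perm (Fin n), ∑ σ₃ : Equiv.Perm (Fin n), ∑ w, ∑ y,
        (if h₁ σ₁ w then 1 else 0) * (if h₃ σ₃ y then 1 else 0) * (if w ∈ R then 1 else 0) *
          (if σ₃ y ∈ T then 1 else 0) * (if σ₂ (σ₁ w) = y then 1 else 0)) =
      ∑ σ₁ : Equiv.Perm (Fin n), ∑ σ₃ : Equiv.Perm (Fin n), ∑ w, ∑ y,
        ∑ R ∈ unaryInputs n, ∑ T ∈ unaryInputs n, ∑ σ₂ : Equiv.Perm (Fin n),
        (if h₁ σ₁ w then 1 else 0) * (if h₃ σ₃ y then 1 else 0) * (if w ∈ R then 1 else 0) *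
          (if σ₃ y ∈ T then 1 else 0) * (if σ₂ (σ₁ w) = y then 1 else 0) := by
    rw [Finset.sum_congr rfl fun R _ => Finset.sum_congr rfl fun T _ => sum_rotate _ _ _ _,
      Finset.sum_congr rfl fun R _ => sum_rotate _ _ _ _, sum_rotate]
    refine Finset.sum_congr rfl fun σ₁ _ => Finset.sum_congr rfl fun σ₃ _ => ?_
    rw [Finset.sum_congr rfl fun R _ => Finset.sum_congr rfl fun T _ => sum_rotate _ _ _ _,
      Finset.sum_congr rfl fun R _ => sum_rotate _ _ _ _, sum_rotate]
  set s := Nat.sqrt n with hs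
  set c := n.choose s with hc
  -- The three factors `n` are the denominators of the independent events `w ∈ R`, `σ₃ y ∈ T` and
  -- `σ₂ (σ₁ w) = y`.
  have hinner : ∀ (σ₁ σ₃ : Equiv.Perm (Fin n)) (w y : Fin n),
      n ^ 3 * (∑ R ∈ unaryInputs n, ∑ T ∈ unaryInputs n, ∑ σ₂ : Equiv.Perm (Fin n),
        (if h₁ σ₁ w then 1 else 0) * (if h₃ σ₃ y then 1 else 0) * (if w ∈ R then 1 else 0) *
          (if σ₃ y ∈ T then 1 else 0) * (if σ₂ (σ₁ w) = y then 1 else 0)) =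
      (if h₁ σ₁ w then 1 else 0) * (if h₃ σ₃ y then 1 else 0) *
        ((s * c) * (s * c) * n.factorial) := by
    intro σ₁ σ₃ w y
    rw [← card_powersetCard_mem s w, ← card_perm_apply_eq (σ₁ w) y]
    -- Both copies of `s * c` were rewritten for `w`; the second is restored so that it can be used
    -- for `σ₃ y`.
    nth_rewrite 2 [card_powersetCard_mem s w]
    rw [← card_powersetCard_mem s (σ₃ y)]
    simp only [← Finset.mul_sum, ← Finset.sum_mul, Finset.card_filter]
    ring
  have hprod : (∑ σ₁ : Equiv.Perm (Fin n), ∑ σ₃ : Equiv.Perm (Fin n), ∑ w, ∑ y,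
      (if h₁ σ₁ w then 1 else 0) * (if h₃ σ₃ y then 1 else 0)) =
      (∑ σ, (Finset.univ.filter fun a => h₁ σ a).card) *
        ∑ σ, (Finset.univ.filter fun a => h₃ σ a).card := by
    simp only [Finset.card_filter, Finset.sum_mul_sum]
  have hss : s * s ≤ n := Nat.sqrt_le n
  refine Nat.le_of_mul_le_mul_left ?_ hn
  calc n * (n ^ 2 * _) = n ^ 3 * _ := by rw [← mul_assoc, ← pow_succ']
    _ = (∑ σ₁ : Equiv.Perm (Fin n), ∑ σ₃ : Equiv.Perm (Fin n), ∑ w, ∑ y,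
          (if h₁ σ₁ w then 1 else 0) * (if h₃ σ₃ y then 1 else 0)) *
            ((s * c) * (s * c) * n.factorial) := by
        rw [hre]
        rw [Finset.mul_sum, Finset.sum_mul]
        refine Finset.sum_congr rfl fun σ₁ _ => ?_
        rw [Finset.mul_sum, Finset.sum_mul]
        refine Finset.sum_congr rfl fun σ₃ _ => ?_
        rw [Finset.mul_sum, Finset.sum_mul]
        refine Finset.sum_congr rfl fun w _ => ?_
        rw [Finset.mul_sum, Finset.sum_mul]
        exact Finset.sum_congr rfl fun y _ => hinner σ₁ σ₃ w y
    _ ≤ (H * n.factorial) * (H * n.factorial) * ((s * c) * (s * c) * n.factorial) := by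
        rw [hprod]
        gcongr
    _ = (s * s) * (H ^ 2 * (inputs n).card) := by
        rw [card_inputs]
        ring
    _ ≤ n * (H ^ 2 * (inputs n).card) := by gcongr

end Worker

/-! ### Success probability of one worker, and of all workers -/

section WorkerBound

variable {n p : ℕ}

open scoped Classical in
/-- A worker that receives few bits about `S₁` and `S₃` rarely finds an answer. -/
lemma OneRoundAlgorithm.card_succeeds_le (A : OneRoundAlgorithm n p) (u : Fin p) (hn : 1 ≤ n)
    (d k ℓ : ℕ) (hd : 0 < d) (h₁ : ∀ σ, (A.msgS₁ (matchingOf σ) u).length ≤ ℓ)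
    (h₃ : ∀ σ, (A.msgS₃ (matchingOf σ) u).length ≤ ℓ)
    (hk : n * 2 ^ (ℓ + 1) * d ^ k ≤ k.factorial) :
    (((inputs n).filter (A.Succeeds u)).card : ℝ)
      ≤ (2 / d + ((k : ℝ) + 1) ^ 2 / (n : ℝ) ^ 2) * (inputs n).card := by
  set g₁ : Equiv.Perm (Fin n) → List Bool := fun σ => A.msgS₁ (matchingOf σ) u with hg₁
  set g₃ : Equiv.Perm (Fin n) → List Bool := fun σ => A.msgS₃ (matchingOf σ) u with hg₃
  choose t ht using A.exists_guess u ⟨0, hn⟩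
  have hB₁ : (Finset.univ.image g₁).card ≤ 2 ^ (ℓ + 1) :=
    card_bitstrings_le ℓ _ (by simpa [hg₁] using h₁)
  have hB₃ : (Finset.univ.image g₃).card ≤ 2 ^ (ℓ + 1) :=
    card_bitstrings_le ℓ _ (by simpa [hg₃] using h₃)
  have hH₁ := sum_card_heavy_le d k _ g₁ (by convert hB₁) hk
  have hH₃ := sum_card_heavy_le d k _ g₃ (by convert hB₃) hk
  have hheavy := sum_heavy_answers_le (fun σ a => Heavy d g₁ (g₁ σ) a (σ a))
    (fun σ a => Heavy d g₃ (g₃ σ) a (σ a)) (k + 1) hn hH₁ hH₃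
  -- the guess uses a light pair of `S₁`
  let L₁ : Finset (Fin n) → Finset (Fin n) → Equiv.Perm (Fin n) → Equiv.Perm (Fin n) →
      Equiv.Perm (Fin n) → Prop := fun R T σ₂ σ₁ σ₃ =>
    σ₁ (t R T σ₂ (g₁ σ₁) (g₃ σ₃)).1 = (t R T σ₂ (g₁ σ₁) (g₃ σ₃)).2.1 ∧
      ¬ Heavy d g₁ (g₁ σ₁) (t R T σ₂ (g₁ σ₁) (g₃ σ₃)).1 (t R T σ₂ (g₁ σ₁) (g₃ σ₃)).2.1
  let L₃ : Finset (Fin n) → Finset (Fin n) → Equiv.Perm (Fin n) → Equiv.Perm (Fin n) →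
      Equiv.Perm (Fin n) → Prop := fun R T σ₂ σ₁ σ₃ =>
    σ₃ (t R T σ₂ (g₁ σ₁) (g₃ σ₃)).2.2.1 = (t R T σ₂ (g₁ σ₁) (g₃ σ₃)).2.2.2 ∧
      ¬ Heavy d g₃ (g₃ σ₃) (t R T σ₂ (g₁ σ₁) (g₃ σ₃)).2.2.1 (t R T σ₂ (g₁ σ₁) (g₃ σ₃)).2.2.2
  have hN : (inputs n).card = ∑ R ∈ unaryInputs n, ∑ T ∈ unaryInputs n,
      ∑ σ₂ : Equiv.Perm (Fin n), ∑ σ : Equiv.Perm (Fin n), n.factorial := by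
    rw [card_inputs]
    simp [Fintype.card_perm]
  have hL₁ : d * (∑ R ∈ unaryInputs n, ∑ T ∈ unaryInputs n, ∑ σ₂ : Equiv.Perm (Fin n),
      ∑ σ₁ : Equiv.Perm (Fin n), ∑ σ₃ : Equiv.Perm (Fin n),
        if L₁ R T σ₂ σ₁ σ₃ then 1 else 0) ≤ (inputs n).card := by
    rw [hN]
    simp only [Finset.mul_sum]
    refine Finset.sum_le_sum fun R _ => Finset.sum_le_sum fun T _ =>
      Finset.sum_le_sum fun σ₂ _ => ?_
    -- With `σ₃` held fixed, the guess depends on `σ₁` through its message only.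
    rw [Finset.sum_comm]
    refine Finset.sum_le_sum fun σ₃ _ => ?_
    rw [← Finset.mul_sum, ← Finset.card_filter]
    exact card_light_guess_le d g₁ (fun m => (t R T σ₂ m (g₃ σ₃)).1)
      (fun m => (t R T σ₂ m (g₃ σ₃)).2.1)
  have hL₃ : d * (∑ R ∈ unaryInputs n, ∑ T ∈ unaryInputs n, ∑ σ₂ : Equiv.Perm (Fin n),
      ∑ σ₁ : Equiv.Perm (Fin n), ∑ σ₃ : Equiv.Perm (Fin n),
        if L₃ R T σ₂ σ₁ σ₃ then 1 else 0) ≤ (inputs n).card := by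
    rw [hN]
    simp only [Finset.mul_sum]
    refine Finset.sum_le_sum fun R _ => Finset.sum_le_sum fun T _ =>
      Finset.sum_le_sum fun σ₂ _ => Finset.sum_le_sum fun σ₁ _ => ?_
    rw [← Finset.mul_sum, ← Finset.card_filter]
    exact card_light_guess_le d g₃ (fun m => (t R T σ₂ (g₁ σ₁) m).2.2.1)
      (fun m => (t R T σ₂ (g₁ σ₁) m).2.2.2)
  -- A successful guess with no light pair is counted in the last sum, at its own `w` and `y`; these
  -- determine `x = σ₁ w` and `z = σ₃ y`.
  have hpoint : ((inputs n).filter (A.Succeeds u)).card ≤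
      (∑ R ∈ unaryInputs n, ∑ T ∈ unaryInputs n, ∑ σ₂ : Equiv.Perm (Fin n),
        ∑ σ₁ : Equiv.Perm (Fin n), ∑ σ₃ : Equiv.Perm (Fin n),
          if L₁ R T σ₂ σ₁ σ₃ then 1 else 0) +
      (∑ R ∈ unaryInputs n, ∑ T ∈ unaryInputs n, ∑ σ₂ : Equiv.Perm (Fin n),
        ∑ σ₁ : Equiv.Perm (Fin n), ∑ σ₃ : Equiv.Perm (Fin n),
          if L₃ R T σ₂ σ₁ σ₃ then 1 else 0) +
      (∑ R ∈ unaryInputs n, ∑ T ∈ unaryInputs n, ∑ σ₂ : Equiv.Perm (Fin n),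
        ∑ σ₁ : Equiv.Perm (Fin n), ∑ σ₃ : Equiv.Perm (Fin n), ∑ w, ∑ y,
          (if Heavy d g₁ (g₁ σ₁) w (σ₁ w) then 1 else 0) *
          (if Heavy d g₃ (g₃ σ₃) y (σ₃ y) then 1 else 0) * (if w ∈ R then 1 else 0) *
          (if σ₃ y ∈ T then 1 else 0) * (if σ₂ (σ₁ w) = y then 1 else 0)) := by
    rw [Finset.card_filter, sum_inputs]
    simp only [← Finset.sum_add_distrib]
    refine Finset.sum_le_sum fun R _ => Finset.sum_le_sum fun T _ =>
      Finset.sum_le_sum fun σ₂ _ => Finset.sum_le_sum fun σ₁ _ => Finset.sum_le_sum fun σ₃ _ => ?_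
    split_ifs with hs hl₁ hl₃ hl₃
    · omega
    · omega
    · omega
    · have hmem := ht R T σ₂ σ₁ σ₃ hs
      rw [mem_answers_ofPerms] at hmem
      set a := t R T σ₂ (g₁ σ₁) (g₃ σ₃) with ha
      obtain ⟨m1, m2, m3, m4, m5⟩ := hmem
      have q1 : Heavy d g₁ (g₁ σ₁) a.1 (σ₁ a.1) := by
        by_contra h
        exact hl₁ ⟨m2, by rwa [m2] at h⟩
      have q3 : Heavy d g₃ (g₃ σ₃) a.2.2.1 (σ₃ a.2.2.1) := by
        by_contra h
        exact hl₃ ⟨m4, by rwa [m4] at h⟩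
      have hterm : 1 ≤ (if Heavy d g₁ (g₁ σ₁) a.1 (σ₁ a.1) then 1 else 0) *
          (if Heavy d g₃ (g₃ σ₃) a.2.2.1 (σ₃ a.2.2.1) then 1 else 0) *
          (if a.1 ∈ R then 1 else 0) *
          (if σ₃ a.2.2.1 ∈ T then 1 else 0) * (if σ₂ (σ₁ a.1) = a.2.2.1 then 1 else 0) := by
        rw [if_pos q1, if_pos q3, if_pos m1, if_pos (by rwa [m4]), if_pos (by rw [m2, m3])]
      simp only [zero_add]
      refine hterm.trans ?_
      refine le_trans ?_ (Finset.single_le_sum (fun _ _ => Nat.zero_le _) (Finset.mem_univ a.1))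
      exact Finset.single_le_sum (f := fun y =>
        (if Heavy d g₁ (g₁ σ₁) a.1 (σ₁ a.1) then 1 else 0) *
          (if Heavy d g₃ (g₃ σ₃) y (σ₃ y) then 1 else 0) *
          (if a.1 ∈ R then 1 else 0) *
          (if σ₃ y ∈ T then 1 else 0) * (if σ₂ (σ₁ a.1) = y then 1 else 0))
        (fun _ _ => Nat.zero_le _) (Finset.mem_univ a.2.2.1)
    all_goals exact Nat.zero_le _
  have hd' : (0 : ℝ) < d := by exact_mod_cast hd
  have hn' : (0 : ℝ) < (n : ℝ) ^ 2 := by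
    have : (0 : ℝ) < n := by exact_mod_cast hn
    positivity
  generalize (∑ R ∈ unaryInputs n, ∑ T ∈ unaryInputs n, ∑ σ₂ : Equiv.Perm (Fin n),
      ∑ σ₁ : Equiv.Perm (Fin n), ∑ σ₃ : Equiv.Perm (Fin n),
        if L₁ R T σ₂ σ₁ σ₃ then 1 else 0) = x₁ at *
  generalize (∑ R ∈ unaryInputs n, ∑ T ∈ unaryInputs n, ∑ σ₂ : Equiv.Perm (Fin n),
      ∑ σ₁ : Equiv.Perm (Fin n), ∑ σ₃ : Equiv.Perm (Fin n),
        if L₃ R T σ₂ σ₁ σ₃ then 1 else 0) = x₃ at *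
  generalize (∑ R ∈ unaryInputs n, ∑ T ∈ unaryInputs n, ∑ σ₂ : Equiv.Perm (Fin n),
        ∑ σ₁ : Equiv.Perm (Fin n), ∑ σ₃ : Equiv.Perm (Fin n), ∑ w, ∑ y,
          (if Heavy d g₁ (g₁ σ₁) w (σ₁ w) then 1 else 0) *
          (if Heavy d g₃ (g₃ σ₃) y (σ₃ y) then 1 else 0) * (if w ∈ R then 1 else 0) *
          (if σ₃ y ∈ T then 1 else 0) * (if σ₂ (σ₁ w) = y then 1 else 0)) = x₂ at *
  have e1 : (x₁ : ℝ) ≤ 1 / d * (inputs n).card := by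
    rw [one_div_mul_eq_div, le_div_iff₀ hd', mul_comm]
    exact_mod_cast hL₁
  have e3 : (x₃ : ℝ) ≤ 1 / d * (inputs n).card := by
    rw [one_div_mul_eq_div, le_div_iff₀ hd', mul_comm]
    exact_mod_cast hL₃
  have e2 : (x₂ : ℝ) ≤ ((k : ℝ) + 1) ^ 2 / (n : ℝ) ^ 2 * (inputs n).card := by
    rw [div_mul_eq_mul_div, le_div_iff₀ hn', mul_comm]
    exact_mod_cast hheavy
  calc (((inputs n).filter (A.Succeeds u)).card : ℝ) ≤ x₁ + x₃ + x₂ := by exact_mod_cast hpoint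
    _ ≤ 1 / d * (inputs n).card + 1 / d * (inputs n).card
        + ((k : ℝ) + 1) ^ 2 / (n : ℝ) ^ 2 * (inputs n).card := by gcongr
    _ = _ := by ring

open scoped Classical in
/-- The number of inputs on which some worker succeeds. -/
lemma OneRoundAlgorithm.card_producesWitness_le (A : OneRoundAlgorithm n p) (hn : 1 ≤ n)
    (d k ℓ : ℕ) (hd : 0 < d) (hA : ∀ D ∈ inputs n, ∀ u, (A.received D u).bits ≤ ℓ)
    (hk : n * 2 ^ (ℓ + 1) * d ^ k ≤ k.factorial) :
    (((inputs n).filter A.ProducesWitness).card : ℝ)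
      ≤ p * (2 / d + ((k : ℝ) + 1) ^ 2 / (n : ℝ) ^ 2) * (inputs n).card := by
  -- The bit bound is known on the input family only, so each permutation is completed to an input.
  obtain ⟨R, hR⟩ : (unaryInputs n).Nonempty := by
    rw [Finset.powersetCard_nonempty]
    simpa using Nat.sqrt_le_self n
  have hbits : ∀ σ u, (A.msgS₁ (matchingOf σ) u).length ≤ ℓ ∧
      (A.msgS₃ (matchingOf σ) u).length ≤ ℓ := by
    intro σ u
    have := hA (.ofPerms R R σ σ σ) ((mem_inputs_iff _).2 ⟨R, hR, R, hR, σ, σ, σ, rfl⟩) u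
    simp only [Received.bits, received, Database.ofPerms_S₁, Database.ofPerms_S₃] at this
    omega
  have hsub : (inputs n).filter A.ProducesWitness ⊆
      Finset.univ.biUnion fun u => (inputs n).filter (A.Succeeds u) := by
    intro D hD
    obtain ⟨h1, u, h2⟩ := Finset.mem_filter.1 hD
    exact Finset.mem_biUnion.2 ⟨u, Finset.mem_univ u, Finset.mem_filter.2 ⟨h1, h2⟩⟩
  calc (((inputs n).filter A.ProducesWitness).card : ℝ)
      ≤ ∑ u, (((inputs n).filter (A.Succeeds u)).card : ℝ) := by
        exact_mod_cast (Finset.card_le_card hsub).trans Finset.card_biUnion_le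
    _ ≤ ∑ _u : Fin p, (2 / d + ((k : ℝ) + 1) ^ 2 / (n : ℝ) ^ 2) * (inputs n).card :=
        Finset.sum_le_sum fun u _ => A.card_succeeds_le u hn d k ℓ hd (fun σ => (hbits σ u).1)
          (fun σ => (hbits σ u).2) hk
    _ = _ := by
        simp only [Finset.sum_const, Finset.card_univ, Fintype.card_fin, nsmul_eq_mul]
        ring

end WorkerBound

/-! ### Averaging over the random bits and over the inputs -/

section Randomized

variable {n p : ℕ}

/-- There are only finitely many workers and possible outputs, so the event is a finite union of
measurable ones. -/
lemma RandomizedAlgorithm.measurableSet_producesWitness (A : RandomizedAlgorithm n p)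
    (D : Database n) :
    letI := A.mΩ
    MeasurableSet {ω | (A.run ω).ProducesWitness D} := by
  let _ := A.mΩ
  have : {ω | (A.run ω).ProducesWitness D} = ⋃ u : Fin p, ⋃ O : Set (Answer n),
      ⋃ _ : O.Nonempty ∧ O ⊆ D.answers, {ω | (A.run ω).outputOn D u = O} := by
    ext ω
    simp [OneRoundAlgorithm.ProducesWitness, and_comm]
  rw [this]
  exact MeasurableSet.iUnion fun u => MeasurableSet.iUnion fun O => MeasurableSet.iUnion fun _ =>
    A.measurable_output D u O

open scoped Classical in
/-- A bound for every choice of the random bits holds on average. -/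
lemma RandomizedAlgorithm.sum_witnessProb_le (A : RandomizedAlgorithm n p) (b : ℝ)
    (hb : ∀ ω, (((inputs n).filter (A.run ω).ProducesWitness).card : ℝ) ≤ b) :
    ∑ D ∈ inputs n, A.witnessProb D ≤ b := by
  let _ := A.mΩ
  have := A.prob
  have hint : ∀ D ∈ inputs n, Integrable
      (Set.indicator {ω | (A.run ω).ProducesWitness D} fun _ => (1 : ℝ)) A.μ := fun D _ =>
    (integrable_const 1).indicator (A.measurableSet_producesWitness D)
  calc ∑ D ∈ inputs n, A.witnessProb D
      = ∑ D ∈ inputs n, ∫ ω, Set.indicator {ω | (A.run ω).ProducesWitness D}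
          (fun _ => (1 : ℝ)) ω ∂A.μ := by
        refine Finset.sum_congr rfl fun D _ => ?_
        rw [integral_indicator (A.measurableSet_producesWitness D)]
        simp [RandomizedAlgorithm.witnessProb]
    _ = ∫ ω, ∑ D ∈ inputs n, Set.indicator {ω | (A.run ω).ProducesWitness D}
          (fun _ => (1 : ℝ)) ω ∂A.μ := (integral_finsetSum _ hint).symm
    _ ≤ ∫ _ω, b ∂A.μ := by
        refine integral_mono (integrable_finsetSum _ hint) (integrable_const b) fun ω => ?_
        refine le_trans (le_of_eq ?_) (hb ω)
        simp [Set.indicator_apply]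
    _ = b := by simp

lemma RandomizedAlgorithm.witnessProb_eq_zero (A : RandomizedAlgorithm n p) (D : Database n)
    (hD : ¬ D.answers.Nonempty) : A.witnessProb D = 0 := by
  have : {ω | (A.run ω).ProducesWitness D} = ∅ := by
    ext ω
    simp only [Set.mem_ofPred_eq, Set.mem_empty_iff_false, iff_false]
    rintro ⟨u, h1, h2⟩
    exact hD (h1.mono h2)
  simp [RandomizedAlgorithm.witnessProb, this]

lemma RandomizedAlgorithm.witnessProb_le_one (A : RandomizedAlgorithm n p) (D : Database n) :
    A.witnessProb D ≤ 1 := by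
  let _ := A.mΩ
  have := A.prob
  exact measureReal_le_one

/-- Inputs without answers contribute zero, so the whole average comes from the at least one fifth
of the inputs that have answers. -/
lemma RandomizedAlgorithm.exists_witnessProb_le (A : RandomizedAlgorithm n p) (hn : 1 ≤ n)
    (b : ℝ) (hb : A.avgWitnessProb ≤ b) :
    ∃ D ∈ inputs n, D.answers.Nonempty ∧ A.witnessProb D ≤ 5 * b := by
  classical
  have hN : (0 : ℝ) < (inputs n).card := by exact_mod_cast (inputs_nonempty n).card_pos
  have hfifth := card_inputs_le_nonempty hn
  set E := (inputs n).filter fun D => D.answers.Nonempty with hE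
  have hE0 : (0 : ℝ) < E.card := by linarith
  by_contra! hcon
  have hEne : E.Nonempty := Finset.card_pos.1 (by exact_mod_cast hE0)
  have h1 : E.card * (5 * b) < ∑ D ∈ E, A.witnessProb D := by
    rw [← nsmul_eq_mul, ← Finset.sum_const]
    refine Finset.sum_lt_sum_of_nonempty hEne fun D hD => ?_
    exact hcon D (Finset.mem_filter.1 hD).1 (Finset.mem_filter.1 hD).2
  have h2 : ∑ D ∈ E, A.witnessProb D = ∑ D ∈ inputs n, A.witnessProb D := by
    refine Finset.sum_subset (Finset.filter_subset _ _) fun D hD hDE => ?_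
    exact A.witnessProb_eq_zero D fun h => hDE (Finset.mem_filter.2 ⟨hD, h⟩)
  have h3 : ∑ D ∈ inputs n, A.witnessProb D ≤ b * (inputs n).card := by
    rwa [RandomizedAlgorithm.avgWitnessProb, div_le_iff₀ hN] at hb
  -- The sign is needed to multiply the one-fifth bound by `b`.
  have h0 : 0 ≤ b := by
    refine le_trans ?_ hb
    exact div_nonneg (Finset.sum_nonneg fun D _ => measureReal_nonneg) hN.le
  nlinarith

end Randomized

/-! ### Numerical estimates for the union bound -/

section Parameters

/-- `k ^ k / k!` is a single term of the series of `exp k`. -/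
lemma div_exp_pow_le_factorial (k : ℕ) :
    ((k : ℝ) / Real.exp 1) ^ k ≤ k.factorial := by
  have h := Real.pow_div_factorial_le_exp (k : ℝ) (Nat.cast_nonneg k) k
  have hf : (0 : ℝ) < k.factorial := by exact_mod_cast k.factorial_pos
  rw [div_le_iff₀ hf] at h
  rw [div_pow, ← Real.exp_nat_mul, mul_one, div_le_iff₀ (Real.exp_pos _), mul_comm]
  exact h

/-- If `k / n` exceeds a multiple of the fraction `f` of the input that a worker receives, a worker
knows `k` pairs of a random matching with negligible probability only. -/
lemma messages_le_factorial {n p k ℓ : ℕ} {c f : ℝ} (hp : 2 ≤ p) (hpn : p ^ 6 ≤ n) (hc : 0 < c)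
    (hf : 1 / (p : ℝ) ≤ f) (hℓ : (ℓ : ℝ) ≤ c * inputBits n * f) (hk : (2 * c + 4) * (f * n) ≤ k) :
    n * 2 ^ (ℓ + 1) * (p ^ 2) ^ k ≤ k.factorial := by
  have hp' : (2 : ℝ) ≤ p := by exact_mod_cast hp
  have hp0 : (0 : ℝ) < p := by linarith
  have hpn' : (p : ℝ) ^ 6 ≤ n := by exact_mod_cast hpn
  have h64 : (64 : ℝ) ≤ n := by
    calc (64 : ℝ) = 2 ^ 6 := by norm_num
      _ ≤ (p : ℝ) ^ 6 := by gcongr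
      _ ≤ n := hpn'
  have hn0 : (0 : ℝ) < n := by linarith
  have hp1n : (p : ℝ) ≤ n := (le_self_pow₀ (by linarith) (by norm_num)).trans hpn'
  have hfn' : (n : ℝ) / p ≤ f * n := by
    calc (n : ℝ) / p = 1 / p * n := by ring
      _ ≤ f * n := by gcongr
  have hfn : 1 ≤ f * n := le_trans ((one_le_div hp0).2 hp1n) hfn'
  have hk4 : 4 * ((n : ℝ) / p) ≤ k := by nlinarith [mul_pos hc (by linarith : 0 < f * n)]
  -- Origin of the exponent 6: `d = p ^ 2` and `k ≥ 4 n / p` together cost `p ^ 3`, which must be at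
  -- most `√n`.
  have hbase : Real.sqrt n ≤ (k : ℝ) / Real.exp 1 / (p : ℝ) ^ 2 := by
    have he : Real.exp 1 ≤ 4 := by linarith [Real.exp_one_lt_d9]
    have hsq : (p : ℝ) ^ 3 ≤ Real.sqrt n := by
      refine Real.le_sqrt_of_sq_le ?_
      rw [← pow_mul]
      exact hpn'
    have hss := Real.mul_self_sqrt hn0.le
    rw [div_div, le_div_iff₀ (by positivity)]
    calc Real.sqrt n * (Real.exp 1 * (p : ℝ) ^ 2)
        = Real.exp 1 * (Real.sqrt n * (p : ℝ) ^ 3 / p) := by field_simp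
      _ ≤ 4 * (Real.sqrt n * Real.sqrt n / p) := by gcongr
      _ ≤ k := by rw [hss]; exact hk4
  -- The left side is at most `n ^ (2 + c f n)`, and `k / 2 ≥ (c + 2) f n ≥ 2 + c f n`; hence the
  -- constant `2 * c + 4`.
  have hmsg : (n : ℝ) * 2 ^ (ℓ + 1) ≤ Real.sqrt n ^ k := by
    have h2 : (2 : ℝ) ^ ℓ ≤ (n : ℝ) ^ (c * (f * n)) := by
      rw [← Real.rpow_natCast]
      calc (2 : ℝ) ^ (ℓ : ℝ) ≤ (2 : ℝ) ^ (Real.logb 2 n * (c * (f * n))) := by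
            refine Real.rpow_le_rpow_of_exponent_le (by norm_num) (hℓ.trans (le_of_eq ?_))
            rw [inputBits]
            ring
        _ = (n : ℝ) ^ (c * (f * n)) := by
            rw [Real.rpow_mul (by norm_num), Real.rpow_logb (by norm_num) (by norm_num) hn0]
    calc (n : ℝ) * 2 ^ (ℓ + 1) = (n * 2) * 2 ^ ℓ := by ring
      _ ≤ (n * n) * (n : ℝ) ^ (c * (f * n)) := by gcongr; linarith
      _ = (n : ℝ) ^ (2 + c * (f * n)) := by
          rw [Real.rpow_add hn0]
          norm_num [sq]
      _ ≤ (n : ℝ) ^ ((1 / 2 : ℝ) * k) := by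
          refine Real.rpow_le_rpow_of_exponent_le (by linarith) ?_
          nlinarith
      _ = Real.sqrt n ^ k := by
          rw [Real.rpow_mul hn0.le, Real.rpow_natCast, Real.sqrt_eq_rpow]
  have hreal : (n : ℝ) * 2 ^ (ℓ + 1) * ((p : ℝ) ^ 2) ^ k ≤ k.factorial := by
    calc (n : ℝ) * 2 ^ (ℓ + 1) * ((p : ℝ) ^ 2) ^ k
        ≤ ((k : ℝ) / Real.exp 1 / (p : ℝ) ^ 2) ^ k * ((p : ℝ) ^ 2) ^ k := by
          gcongr
          exact hmsg.trans (by gcongr)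
      _ = ((k : ℝ) / Real.exp 1) ^ k := by
          rw [← mul_pow, div_mul_cancel₀ _ (by positivity)]
      _ ≤ k.factorial := div_exp_pow_le_factorial k
  exact_mod_cast hreal

end Parameters

/-! ### The bound on a random input -/

section Main

variable {n p : ℕ}

/-- On a random input, a witness is produced with probability `O(p^(-(1-2ε)))`. -/
theorem RandomizedAlgorithm.avgWitnessProb_le (A : RandomizedAlgorithm n p) {ε c : ℝ}
    (hε : 0 ≤ ε) (hc : 0 < c) (hp : 1 ≤ p) (hpn : p ^ 6 ≤ n)
    (hA : A.IsMPC ε c) :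
    A.avgWitnessProb ≤ (2 + (2 * c + 6) ^ 2) * (p : ℝ) ^ (-(1 - 2 * ε)) := by
  have hn : 1 ≤ n := (Nat.one_le_pow _ _ hp).trans hpn
  have hN : (0 : ℝ) < (inputs n).card := by exact_mod_cast (inputs_nonempty n).card_pos
  rw [RandomizedAlgorithm.avgWitnessProb, div_le_iff₀ hN]
  -- For `p = 1` the bound exceeds 1; the numerical estimates need `p ≥ 2`.
  rcases hp.eq_or_lt with rfl | hp2
  · calc ∑ D ∈ inputs n, A.witnessProb D ≤ ∑ _D ∈ inputs n, (1 : ℝ) :=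
          Finset.sum_le_sum fun D _ => A.witnessProb_le_one D
      _ = 1 * (inputs n).card := by simp
      _ ≤ _ := by
          gcongr
          rw [Nat.cast_one, Real.one_rpow]
          nlinarith
  have hp' : (2 : ℝ) ≤ p := by exact_mod_cast hp2
  have hp0 : (0 : ℝ) < p := by linarith
  have hn0 : (0 : ℝ) < n := by exact_mod_cast hn
  set f : ℝ := (p : ℝ) ^ (-(1 - ε)) with hf
  have hf0 : 0 < f := Real.rpow_pos_of_pos hp0 _
  have hpf : 1 / (p : ℝ) ≤ f := by
    rw [one_div, ← Real.rpow_neg_one]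
    exact Real.rpow_le_rpow_of_exponent_le (by linarith) (by linarith)
  have hp1n : (p : ℝ) ≤ n := by
    have : p ≤ n := (Nat.le_self_pow (by norm_num) p).trans hpn
    exact_mod_cast this
  have hfn : 1 ≤ f * n := by
    calc (1 : ℝ) ≤ n / p := (one_le_div hp0).2 hp1n
      _ = 1 / p * n := by ring
      _ ≤ f * n := by gcongr
  set k := ⌈(2 * c + 4) * (f * n)⌉₊ with hk
  have hk1 : (2 * c + 4) * (f * n) ≤ k := Nat.le_ceil _
  -- Rounding up and the extra 1 cost at most 2, absorbed by `1 ≤ f * n`.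
  have hk2 : (k : ℝ) + 1 ≤ (2 * c + 6) * (f * n) := by
    have := Nat.ceil_lt_add_one (a := (2 * c + 4) * (f * n)) (by positivity)
    linarith
  set ℓ := ⌊c * inputBits n * f⌋₊ with hℓ
  have hbits : 0 ≤ c * inputBits n * f := by
    have : 0 ≤ Real.logb 2 n := Real.logb_nonneg (by norm_num) (by exact_mod_cast hn)
    rw [inputBits]
    positivity
  have hfac := messages_le_factorial (ℓ := ℓ) hp2 hpn hc hpf (Nat.floor_le hbits) hk1
  refine A.sum_witnessProb_le _ fun ω => ?_
  -- With `d = p ^ 2` light guesses cost `2 / p ^ 2 ≤ 2 * f ^ 2`, no more than the order of the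
  -- heavy term.
  refine ((A.run ω).card_producesWitness_le hn (p ^ 2) k ℓ (by positivity) ?_ hfac).trans ?_
  · intro D hD u
    refine Nat.le_floor ((hA ω D hD u).trans (le_of_eq ?_))
    rw [hf, Real.rpow_neg hp0.le, div_eq_mul_inv]
  · refine mul_le_mul_of_nonneg_right ?_ hN.le
    have hff : (p : ℝ) * f ^ 2 = (p : ℝ) ^ (-(1 - 2 * ε)) := by
      rw [hf, ← Real.rpow_natCast, ← Real.rpow_mul hp0.le]
      nth_rewrite 1 [← Real.rpow_one (p : ℝ)]
      rw [← Real.rpow_add hp0]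
      congr 1
      push_cast
      ring
    rw [← hff]
    have h1 : (2 : ℝ) / ((p ^ 2 : ℕ) : ℝ) ≤ 2 * f ^ 2 := by
      calc (2 : ℝ) / ((p ^ 2 : ℕ) : ℝ) = 2 * (1 / p) ^ 2 := by push_cast; ring
        _ ≤ 2 * f ^ 2 := by gcongr
    have h2 : ((k : ℝ) + 1) ^ 2 / (n : ℝ) ^ 2 ≤ (2 * c + 6) ^ 2 * f ^ 2 := by
      rw [div_le_iff₀ (by positivity)]
      calc ((k : ℝ) + 1) ^ 2 ≤ ((2 * c + 6) * (f * n)) ^ 2 := by gcongr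
        _ = _ := by ring
    calc (p : ℝ) * (2 / ((p ^ 2 : ℕ) : ℝ) + ((k : ℝ) + 1) ^ 2 / (n : ℝ) ^ 2)
        ≤ p * (2 * f ^ 2 + (2 * c + 6) ^ 2 * f ^ 2) := by gcongr
      _ = _ := by ring

end Main

end JoinWitness

theorem mainTheorem12 :
    ∃ K : ℕ, ∀ ε c : ℝ, 0 ≤ ε → ε < 1 / 2 → 0 < c →
      (∃ C : ℝ, ∀ p n : ℕ, 1 ≤ p → p ^ K ≤ n →
        ∀ A : JoinWitness.RandomizedAlgorithm n p, A.IsMPC ε c →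
          A.avgWitnessProb ≤ C * (p : ℝ) ^ (-(1 - 2 * ε)) ∧
          ∃ D ∈ JoinWitness.inputs n, D.answers.Nonempty ∧
            A.witnessProb D ≤ C * (p : ℝ) ^ (-(1 - 2 * ε))) ∧
      (∀ η : ℝ, η < 1 → ∃ p₀ : ℕ, ∀ p n : ℕ, p₀ ≤ p → p ^ K ≤ n →
        ¬ ∃ A : JoinWitness.RandomizedAlgorithm n p, A.IsMPC ε c ∧ A.SolvesJoinWitness η) := by
  refine ⟨6, fun ε c hε hε2 hc => ⟨⟨5 * (2 + (2 * c + 6) ^ 2), ?_⟩, ?_⟩⟩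
  · intro p n hp hpn A hA
    have havg := A.avgWitnessProb_le hε hc hp hpn hA
    have hpos : (0 : ℝ) ≤ (2 + (2 * c + 6) ^ 2) * (p : ℝ) ^ (-(1 - 2 * ε)) := by positivity
    refine ⟨by linarith, ?_⟩
    rw [mul_assoc]
    exact A.exists_witnessProb_le ((Nat.one_le_pow _ _ hp).trans hpn) _ havg
  -- Since `ε < 1/2`, the bound tends to 0 and eventually falls below `1 - η`.
  · intro η hη
    have hlim : Filter.Tendsto
        (fun p : ℕ => 5 * ((2 + (2 * c + 6) ^ 2) * (p : ℝ) ^ (-(1 - 2 * ε))))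
        Filter.atTop (nhds (5 * ((2 + (2 * c + 6) ^ 2) * 0))) :=
      (((tendsto_rpow_neg_atTop (by linarith : 0 < 1 - 2 * ε)).comp
        tendsto_natCast_atTop_atTop).const_mul _).const_mul _
    rw [mul_zero, mul_zero] at hlim
    obtain ⟨p₀, hp₀⟩ := Filter.eventually_atTop.1
      (hlim.eventually_lt_const (by linarith : (0 : ℝ) < 1 - η))
    refine ⟨max p₀ 1, ?_⟩
    rintro p n hp hpn ⟨A, hA, hsolve⟩
    have hp1 : 1 ≤ p := (le_max_right _ _).trans hp
    obtain ⟨D, hD, hne, hle⟩ := A.exists_witnessProb_le ((Nat.one_le_pow _ _ hp1).trans hpn) _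
      (A.avgWitnessProb_le hε hc hp1 hpn hA)
    have := hp₀ p ((le_max_left _ _).trans hp)
    have := hsolve D hD hne
    linarith
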